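/- Let $H^1(\mathbb{R}^2)$ be the Sobolev space of real-valued functions with norm $\|u\|_{H^1(\mathbb{R}^2)}^2=\int_{\mathbb{R}^2}(|\nabla u|^2+u^2)\,dx$, let $\partial_\theta := x_1\partial_{x_2}-x_2\partial_{x_1}$ be the angular derivative (with weak partial derivatives), and set $$H:=\Bigl\{u\in H^1(\mathbb{R}^2): \int_{\mathbb{R}^2}|\partial_\theta u|^2\,dx<\infty\Bigr\}.$$ Let $p>2$. For $\lambda>0$, a function $u\in H$ is called a weak solution of $$-\Delta u-\frac{1}{\lambda^2}\,\partial_\theta^2u+u=|u|^{p-2}u\qquad\text{in }\mathbb{R}^2 \tag{$*$}$$ if $$\int_{\mathbb{R}^2}\Bigl(\nabla u\cdot\nabla v+\frac{1}{\lambda^2}(\partial_\theta u)(\partial_\theta v)+uv\Bigr)dx=\int_{\mathbb{R}^2}|u|^{p-2}u\,v\,dx\qquad\text{for all }v\in H.$$ **Lemma.** For every $p>2$ there exist constants $C,\sigma>0$, depending only on $p$, such that for every $\lambda>0$ and every weak solution $u\in H$ of $(*)$ we have $u\in L^\infty(\mathbb{R}^2)$ and $$\|u\|_{L^\infty(\mathbb{R}^2)}\le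 C\,\|u\|_{H^1(\mathbb{R}^2)}^{\sigma}.$$ -/

import Mathlib

open MeasureTheory
open scoped ContDiff

noncomputable section

namespace AngularSchrodinger

/-- The plane `ℝ²` with its Euclidean structure and Lebesgue measure; `x 0` and `x 1` are the
first and the second coordinate of `x`. -/
abbrev Plane := EuclideanSpace ℝ (Fin 2)

/-- `g` is the weak partial derivative of `u` in the `i`-th coordinate direction:
`∫ u ∂ᵢφ = - ∫ g φ` for all real test functions `φ ∈ C_c^∞(ℝ²)`. -/
def HasWeakPartial (i : Fin 2) (u g : Plane → ℝ) : Prop :=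
  LocallyIntegrable u volume ∧ LocallyIntegrable g volume ∧
    ∀ φ : Plane → ℝ, ContDiff ℝ ∞ φ → HasCompactSupport φ →
      ∫ x, u x * fderiv ℝ φ x (EuclideanSpace.single i 1) = - ∫ x, g x * φ x

open Classical in
/-- The weak partial derivative `∂ᵢu`, which is unique up to equality almost everywhere
(and set to `0` if it does not exist). -/
def weakPartial (i : Fin 2) (u : Plane → ℝ) : Plane → ℝ :=
  if h : ∃ g, HasWeakPartial i u g then h.choose else 0

/-- The angular derivative `∂_θ u = x₁ ∂₂u - x₂ ∂₁u`. -/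
def angularDeriv (u : Plane → ℝ) : Plane → ℝ :=
  fun x => x 0 * weakPartial 1 u x - x 1 * weakPartial 0 u x

/-- `u ∈ H¹(ℝ²)`. -/
def MemH1 (u : Plane → ℝ) : Prop :=
  MemLp u 2 volume ∧ ∀ i : Fin 2, ∃ g, HasWeakPartial i u g ∧ MemLp g 2 volume

/-- `u ∈ H`: `u ∈ H¹(ℝ²)` and `∂_θ u` is square integrable. -/
def MemH (u : Plane → ℝ) : Prop :=
  MemH1 u ∧ MemLp (angularDeriv u) 2 volume

/-- The norm of `H¹(ℝ²)`: `‖u‖² = ∫ (|∇u|² + |u|²)`. -/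
def normH1 (u : Plane → ℝ) : ℝ :=
  Real.sqrt (∫ x, ((∑ i : Fin 2, weakPartial i u x ^ 2) + u x ^ 2))

/-- The scalar product `⟨u, v⟩_λ = ∫ (∇u · ∇v + λ⁻² (∂_θ u) (∂_θ v) + u v)` on `H`. -/
def innerH (lam : ℝ) (u v : Plane → ℝ) : ℝ :=
  ∫ x, ((∑ i : Fin 2, weakPartial i u x * weakPartial i v x)
    + 1 / lam ^ 2 * (angularDeriv u x * angularDeriv v x) + u x * v x)

/-- `u ∈ H` is a weak solution of `-Δu - λ⁻² ∂_θ² u + u = |u|^(p-2) u` on `ℝ²`: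
`⟨u, v⟩_λ = ∫ |u|^(p-2) u v` for all `v ∈ H`. -/
def IsWeakSolution (p lam : ℝ) (u : Plane → ℝ) : Prop :=
  MemH u ∧ ∀ v : Plane → ℝ, MemH v →
    innerH lam u v = ∫ x, |u x| ^ (p - 2) * u x * v x

/-- Weak partial derivatives are unique, so that `weakPartial` does not depend on the choice
made in its definition. -/
theorem HasWeakPartial.weakPartial_ae_eq {i : Fin 2} {u g : Plane → ℝ}
    (h : HasWeakPartial i u g) : weakPartial i u =ᵐ[volume] g := by
  have hex : ∃ g, HasWeakPartial i u g := ⟨g, h⟩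
  have hw : HasWeakPartial i u (weakPartial i u) := by
    simp only [weakPartial, hex, dif_pos]
    exact hex.choose_spec
  refine ae_eq_of_integral_contDiff_smul_eq hw.2.1 h.2.1 fun φ hφ hc => ?_
  have h1 := hw.2.2 φ hφ hc
  have h2 := h.2.2 φ hφ hc
  simp only [smul_eq_mul, mul_comm (φ _)]
  linarith

/-- The weak partial derivatives of a function in `H¹(ℝ²)` are square integrable. -/
theorem MemH1.memLp_weakPartial {u : Plane → ℝ} (h : MemH1 u) (i : Fin 2) :
    MemLp (weakPartial i u) 2 volume := by
  obtain ⟨g, hg, hg2⟩ := h.2 i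
  exact (memLp_congr_ae hg.weakPartial_ae_eq).2 hg2

end AngularSchrodinger

end

noncomputable section

namespace AngularSchrodinger

open Filter Topology
open scoped Convolution ENNReal

/-! The bound is a Stampacchia truncation argument. Testing with `G(u)`, where `G` vanishes on `[-k,
k]` and `0 ≤ G' ≤ 1`, makes the angular term nonnegative. It can be dropped, and this is the only
place where `λ` enters, so all constants are independent of `λ`. What remains bounds the `H¹` norm
of `G(u)` by an integral of a power of `u` over the superlevel set `{|u| > k}`.

The embedding of `H¹` into `L⁸` and a Cauchy–Schwarz inequality on that set turn this into `(h - k)⁸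
|{|u| > h}| ≤ D⁸ |{|u| > k}|²` for `1 ≤ k < h`, with `D` a multiple of `‖u‖^(j+1)`. The square on
the right forces the measure to vanish at a finite level (`eq_zero_of_level_decay`), whence `|u| ≤ 1
+ ‖u‖ + 4 D` almost everywhere.

To reach a pure power of the norm, the terms `1 + ‖u‖` are absorbed: testing with `u` itself shows
that nontrivial solutions have `H¹` norm bounded below (`exists_normH1_lower_bound`). The chain rule
and the Sobolev inequality for weak derivatives are obtained by mollification. -/

/-! ### Mollification and density of smooth functions -/

/-- Translations act continuously on `L²`. -/
theorem tendsto_eLpNorm_translate_sub {f : Plane → ℝ} (hf : MemLp f 2 volume) :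
    Tendsto (fun y : Plane => eLpNorm (fun x => f (x - y) - f x) 2 volume) (𝓝 0) (𝓝 0) := by
  let T : C(Plane, C(Plane, Plane)) :=
    (ContinuousMap.mk (fun a : Plane × Plane => a.2 - a.1) (by fun_prop)).curry
  have hT : ∀ y, MeasurePreserving (T y) volume volume := fun y =>
    measurePreserving_sub_right volume y
  have hc : Continuous fun y => Lp.compMeasurePreserving (T y) (hT y) (hf.toLp f) :=
    Continuous.compMeasurePreservingLp continuous_const T.continuous hT (by simp)
  have h0 := (hc.tendsto 0)
  rw [tendsto_iff_edist_tendsto_0] at h0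
  refine h0.congr fun y => ?_
  rw [Lp.edist_def]
  refine eLpNorm_congr_ae ?_
  have e1 : ∀ y, (Lp.compMeasurePreserving (T y) (hT y) (hf.toLp f) : Plane → ℝ)
      =ᵐ[volume] fun x => f (x - y) := fun y =>
    (Lp.coeFn_compMeasurePreserving _ (hT y)).trans
      ((hT y).quasiMeasurePreserving.ae_eq_comp hf.coeFn_toLp)
  filter_upwards [e1 y, e1 0] with x h1 h2
  rw [Pi.sub_apply, h1, h2, sub_zero]

/-- Convolution with a normalized bump function moves `f` in `L²` at most as much as the
translations by vectors from the support of the bump function. -/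
theorem eLpNorm_normed_convolution_sub_le {f : Plane → ℝ} (hf : MemLp f 2 volume)
    (φ : ContDiffBump (0 : Plane)) {δ : ℝ≥0∞}
    (hδ : ∀ y ∈ Metric.ball (0 : Plane) φ.rOut,
      eLpNorm (fun x => f (x - y) - f x) 2 volume ≤ δ) :
    eLpNorm (φ.normed volume ⋆[ContinuousLinearMap.mul ℝ ℝ, volume] f - f) 2 volume ≤ δ := by
  -- Tonelli's theorem below needs joint measurability of `f (x - y) - f x`; both hypothesis and
  -- conclusion survive a change of `f` on a null set.
  wlog hm : StronglyMeasurable f generalizing f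
  · have hfm := hf.1.stronglyMeasurable_mk
    have hae := hf.1.ae_eq_mk
    have := this (f := hf.1.mk f) ((memLp_congr_ae hae).1 hf) (fun y hy => ?_) hfm
    · rw [← convolution_congr _ EventuallyEq.rfl hae] at this
      rwa [eLpNorm_congr_ae ((EventuallyEq.refl _ _).sub hae)]
    · rw [← eLpNorm_congr_ae]
      · exact hδ y hy
      · exact ((measurePreserving_sub_right volume y).quasiMeasurePreserving.ae_eq_comp hae).sub hae
  set k := φ.normed volume with hk
  have hk0 : ∀ y, 0 ≤ k y := φ.nonneg_normed
  have hki : Integrable k volume := φ.integrable_normed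
  have hk1 : ∫ y, k y = 1 := φ.integral_normed
  have hkm : Measurable fun y => ENNReal.ofReal (k y) :=
    φ.continuous_normed.measurable.ennreal_ofReal
  -- Since `ν` has mass one, `L¹(ν) ≤ L²(ν)` plays the role of Jensen's inequality; Tonelli then
  -- reduces the claim to single translations.
  set ν : Measure Plane := volume.withDensity fun y => ENNReal.ofReal (k y) with hν
  have hprob : IsProbabilityMeasure ν := ⟨by
    rw [hν, withDensity_apply _ MeasurableSet.univ, Measure.restrict_univ,
      ← ofReal_integral_eq_lintegral_ofReal hki (ae_of_all _ hk0), hk1, ENNReal.ofReal_one]⟩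
  have hfl : LocallyIntegrable f volume := hf.locallyIntegrable (by norm_num)
  have hex := (φ.hasCompactSupport_normed (μ := volume)).convolutionExists_left
    (ContinuousLinearMap.mul ℝ ℝ) φ.continuous_normed hfl
  have hpt : ∀ x, ‖(k ⋆[ContinuousLinearMap.mul ℝ ℝ, volume] f - f) x‖ₑ ^ (2 : ℝ)
      ≤ ∫⁻ y, ‖f (x - y) - f x‖ₑ ^ (2 : ℝ) ∂ν := by
    intro x
    have h1 : (k ⋆[ContinuousLinearMap.mul ℝ ℝ, volume] f - f) x
        = ∫ y, k y * (f (x - y) - f x) := by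
      have hi1 : Integrable (fun y => k y * f (x - y)) volume := hex x
      simp only [Pi.sub_apply, convolution_def, ContinuousLinearMap.mul_apply', mul_sub]
      rw [integral_sub hi1 (hki.mul_const _), integral_mul_const, hk1, one_mul]
    have h2 : ‖(k ⋆[ContinuousLinearMap.mul ℝ ℝ, volume] f - f) x‖ₑ
        ≤ ∫⁻ y, ‖f (x - y) - f x‖ₑ ∂ν := by
      rw [h1]
      refine (enorm_integral_le_lintegral_enorm _).trans (le_of_eq ?_)
      rw [hν, lintegral_withDensity_eq_lintegral_mul _ hkm (by fun_prop)]
      refine lintegral_congr fun y => ?_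
      simp [enorm_mul, Real.enorm_of_nonneg (hk0 y)]
    have h3 : eLpNorm (fun y => f (x - y) - f x) 1 ν ≤ eLpNorm (fun y => f (x - y) - f x) 2 ν :=
      eLpNorm_le_eLpNorm_of_exponent_le (by norm_num) (by
        exact (hm.comp_measurable (by fun_prop)).aestronglyMeasurable.sub
          aestronglyMeasurable_const)
    rw [eLpNorm_one_eq_lintegral_enorm, eLpNorm_eq_lintegral_rpow_enorm_toReal (by simp) (by simp)]
      at h3
    refine (ENNReal.rpow_le_rpow (h2.trans h3) (by norm_num)).trans (le_of_eq ?_)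
    rw [← ENNReal.rpow_mul]
    simp
  have hsq : ∀ g : Plane → ℝ, eLpNorm g 2 volume ^ (2 : ℝ) = ∫⁻ x, ‖g x‖ₑ ^ (2 : ℝ) := fun g => by
    rw [eLpNorm_eq_lintegral_rpow_enorm_toReal (by simp) (by simp), ← ENNReal.rpow_mul]
    simp
  rw [← ENNReal.rpow_le_rpow_iff (z := 2) (by norm_num), hsq]
  have hmeas : Measurable (Function.uncurry fun x y : Plane => ‖f (x - y) - f x‖ₑ ^ (2 : ℝ)) := by
    have hfm := hm.measurable
    unfold Function.uncurry
    fun_prop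
  calc ∫⁻ x, ‖(k ⋆[ContinuousLinearMap.mul ℝ ℝ, volume] f - f) x‖ₑ ^ (2 : ℝ)
      ≤ ∫⁻ x, ∫⁻ y, ‖f (x - y) - f x‖ₑ ^ (2 : ℝ) ∂ν := lintegral_mono hpt
    _ = ∫⁻ y, (∫⁻ x, ‖f (x - y) - f x‖ₑ ^ (2 : ℝ)) ∂ν := lintegral_lintegral_swap hmeas.aemeasurable
    _ ≤ ∫⁻ y, δ ^ (2 : ℝ) ∂ν := by
      refine lintegral_mono_ae ?_
      rw [hν, ae_withDensity_iff hkm]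
      refine ae_of_all _ fun y hy => ?_
      rw [← hsq]
      refine ENNReal.rpow_le_rpow (hδ y ?_) (by norm_num)
      rw [← φ.support_normed_eq (μ := volume)]
      intro h0
      exact hy (by simp [hk, h0])
    _ = δ ^ (2 : ℝ) := by simp

/-- A sequence of bump functions shrinking to the origin. -/
def shrinkingBump (n : ℕ) : ContDiffBump (0 : Plane) where
  rIn := 1 / (2 * ((n : ℝ) + 1))
  rOut := 1 / ((n : ℝ) + 1)
  rIn_pos := by positivity
  rIn_lt_rOut := by
    apply one_div_lt_one_div_of_lt <;> nlinarith [(Nat.cast_nonneg n : (0 : ℝ) ≤ n)]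

theorem tendsto_eLpNorm_mollify_sub {f : Plane → ℝ} (hf : MemLp f 2 volume) :
    Tendsto (fun n => eLpNorm ((shrinkingBump n).normed volume
      ⋆[ContinuousLinearMap.mul ℝ ℝ, volume] f - f) 2 volume) atTop (𝓝 0) := by
  rw [ENNReal.tendsto_nhds_zero]
  intro δ hδ
  have h := (ENNReal.tendsto_nhds_zero.1 (tendsto_eLpNorm_translate_sub hf)) δ hδ
  obtain ⟨r, hr, hb⟩ := Metric.eventually_nhds_iff_ball.1 h
  have hlim : Tendsto (fun n : ℕ => 1 / ((n : ℝ) + 1)) atTop (𝓝 0) :=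
    tendsto_one_div_add_atTop_nhds_zero_nat
  filter_upwards [hlim.eventually_lt_const hr] with n hn
  exact eLpNorm_normed_convolution_sub_le hf _ fun y hy =>
    hb y (Metric.ball_subset_ball hn.le hy)

/-- Mollification commutes with weak partial derivatives. -/
theorem HasWeakPartial.fderiv_mollify {i : Fin 2} {u g : Plane → ℝ} (h : HasWeakPartial i u g)
    (φ : ContDiffBump (0 : Plane)) (x : Plane) :
    fderiv ℝ (φ.normed volume ⋆[ContinuousLinearMap.mul ℝ ℝ, volume] u) x
        (EuclideanSpace.single i 1)
      = (φ.normed volume ⋆[ContinuousLinearMap.mul ℝ ℝ, volume] g) x := by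
  set k := φ.normed volume with hk
  have hks : ContDiff ℝ ∞ k := φ.contDiff_normed
  have hkc : HasCompactSupport k := φ.hasCompactSupport_normed
  have hk1 : ContDiff ℝ 1 k := hks.of_le (by simp)
  have hd := hkc.hasFDerivAt_convolution_left (ContinuousLinearMap.mul ℝ ℝ) hk1 h.1 x
  have hex : ConvolutionExistsAt (fderiv ℝ k) u x
      ((ContinuousLinearMap.mul ℝ ℝ).precompL Plane) volume :=
    (hkc.fderiv ℝ).convolutionExists_left _ (hk1.continuous_fderiv (by simp)) h.1 x
  rw [hd.fderiv, convolution_eq_swap, convolution_eq_swap,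
    ContinuousLinearMap.integral_apply hex.integrable_swap]
  -- The reflected kernel is the test function; the sign from the reflection cancels the one in the
  -- integration by parts.
  have htest := h.2.2 (fun y => k (x - y)) (hks.comp (contDiff_const.sub contDiff_id))
    (hkc.comp_homeomorph (Homeomorph.subLeft x))
  have hfd : ∀ y, fderiv ℝ (fun y => k (x - y)) y (EuclideanSpace.single i 1)
      = - fderiv ℝ k (x - y) (EuclideanSpace.single i 1) := by
    intro y
    have h1 : HasFDerivAt k (fderiv ℝ k (x - y)) (x - y) :=
      (hk1.differentiable (by simp) _).hasFDerivAt
    have h2 : HasFDerivAt (fun y => x - y) (-ContinuousLinearMap.id ℝ Plane) y :=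
      (hasFDerivAt_id y).const_sub x
    have h3 : HasFDerivAt (fun y => k (x - y))
        ((fderiv ℝ k (x - y)).comp (-ContinuousLinearMap.id ℝ Plane)) y := h1.comp y h2
    rw [h3.fderiv]
    simp
  simp only [hfd, mul_neg, integral_neg, neg_inj] at htest
  simp only [ContinuousLinearMap.precompL_apply, ContinuousLinearMap.mul_apply']
  calc _ = ∫ y, u y * fderiv ℝ k (x - y) (EuclideanSpace.single i 1) :=
        integral_congr_ae (ae_of_all _ fun y => mul_comm _ _)
    _ = ∫ y, g y * k (x - y) := htest
    _ = _ := integral_congr_ae (ae_of_all _ fun y => mul_comm _ _)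

/-- Smooth functions are dense among the functions with weak partial derivatives in `L²`. -/
theorem exists_smooth_approx {u : Plane → ℝ} {g : Fin 2 → Plane → ℝ} (hu : MemLp u 2 volume)
    (hg : ∀ i, HasWeakPartial i u (g i)) (hg2 : ∀ i, MemLp (g i) 2 volume) :
    ∃ w : ℕ → Plane → ℝ, (∀ n, ContDiff ℝ ∞ (w n)) ∧
      Tendsto (fun n => eLpNorm (w n - u) 2 volume) atTop (𝓝 0) ∧
      ∀ i, Tendsto (fun n => eLpNorm
        ((fun x => fderiv ℝ (w n) x (EuclideanSpace.single i 1)) - g i) 2 volume)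
        atTop (𝓝 0) := by
  refine ⟨fun n => (shrinkingBump n).normed volume ⋆[ContinuousLinearMap.mul ℝ ℝ, volume] u,
    fun n => ?_, tendsto_eLpNorm_mollify_sub hu, fun i => ?_⟩
  · exact (shrinkingBump n).hasCompactSupport_normed.contDiff_convolution_left _
      (shrinkingBump n).contDiff_normed (hu.locallyIntegrable (by norm_num))
  · simp only [(hg i).fderiv_mollify]
    exact tendsto_eLpNorm_mollify_sub (hg2 i)

/-! ### Chain rule and stability of `H` under composition -/

/-- The pairing `(A, B) ↦ ∫ A B` is continuous in `A ∈ L²` for fixed `B ∈ L²`. -/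
theorem tendsto_integral_mul_of_tendsto_eLpNorm {A : ℕ → Plane → ℝ} {A₀ B : Plane → ℝ}
    (hA : ∀ n, AEStronglyMeasurable (A n) volume) (hA₀ : MemLp A₀ 2 volume)
    (hB : MemLp B 2 volume) (h : Tendsto (fun n => eLpNorm (A n - A₀) 2 volume) atTop (𝓝 0)) :
    Tendsto (fun n => ∫ x, A n x * B x) atTop (𝓝 (∫ x, A₀ x * B x)) := by
  have hev : ∀ᶠ n in atTop, MemLp (A n) 2 volume := by
    filter_upwards [h.eventually_lt_const (u := 1) (by simp)] with n hn
    have : MemLp (A n - A₀) 2 volume := ⟨(hA n).sub hA₀.1, hn.trans (by simp)⟩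
    simpa using this.add hA₀
  refine tendsto_integral_of_L1' (fun x => A₀ x * B x) (hA₀.integrable_mul hB).1
    (hev.mono fun n hn => hn.integrable_mul hB) ?_
  have hle : ∀ n, eLpNorm ((fun x => A n x * B x) - fun x => A₀ x * B x) 1 volume
      ≤ eLpNorm (A n - A₀) 2 volume * eLpNorm B 2 volume := by
    intro n
    have := eLpNorm_smul_le_mul_eLpNorm (p := 2) (q := 2) (r := 1) (μ := volume) hB.1
      ((hA n).sub hA₀.1)
    refine le_trans (le_of_eq ?_) this
    congr 1
    ext x
    simp [sub_mul]
  refine tendsto_of_tendsto_of_tendsto_of_le_of_le tendsto_const_nhds ?_ (fun _ => zero_le) hle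
  have := ENNReal.Tendsto.mul_const h (Or.inr hB.2.ne)
  simpa using this

/-- A function with derivative bounded by one is Lipschitz with constant one. -/
theorem abs_sub_le_of_abs_deriv_le_one {G G' : ℝ → ℝ} (hG : ∀ t, HasDerivAt G (G' t) t)
    (hb : ∀ t, |G' t| ≤ 1) (a b : ℝ) : |G a - G b| ≤ |a - b| := by
  have := Convex.norm_image_sub_le_of_norm_hasDerivWithin_le (s := Set.univ) (C := 1)
    (fun t _ => (hG t).hasDerivWithinAt) (fun t _ => hb t) convex_univ (Set.mem_univ b)
    (Set.mem_univ a)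
  simpa using this

theorem memLp_comp_of_abs_deriv_le_one {u : Plane → ℝ} {q : ℝ≥0∞} (hu : MemLp u q volume)
    {G G' : ℝ → ℝ}
    (hG : ∀ t, HasDerivAt G (G' t) t) (hb : ∀ t, |G' t| ≤ 1) (h0 : G 0 = 0) :
    MemLp (fun x => G (u x)) q volume := by
  have hc : Continuous G := continuous_iff_continuousAt.2 fun t => (hG t).continuousAt
  refine hu.mono (hc.comp_aestronglyMeasurable hu.1) (ae_of_all _ fun x => ?_)
  simpa [h0] using abs_sub_le_of_abs_deriv_le_one hG hb (u x) 0

theorem memLp_comp_mul_of_abs_le_one {u g : Plane → ℝ} (hu : AEStronglyMeasurable u volume)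
    (hg : MemLp g 2 volume) {G' : ℝ → ℝ} (hc : Continuous G') (hb : ∀ t, |G' t| ≤ 1) :
    MemLp (fun x => G' (u x) * g x) 2 volume := by
  refine hg.mono ((hc.comp_aestronglyMeasurable hu).mul hg.1) (ae_of_all _ fun x => ?_)
  rw [norm_mul]
  exact mul_le_of_le_one_left (norm_nonneg _) (hb _)

/-- The chain rule for weak partial derivatives. -/
theorem hasWeakPartial_comp {u : Plane → ℝ} {g : Fin 2 → Plane → ℝ} (hu : MemLp u 2 volume)
    (hg : ∀ i, HasWeakPartial i u (g i)) (hg2 : ∀ i, MemLp (g i) 2 volume)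
    {G G' : ℝ → ℝ} (hG : ∀ t, HasDerivAt G (G' t) t) (hc : Continuous G')
    (hb : ∀ t, |G' t| ≤ 1) (h0 : G 0 = 0) (i : Fin 2) :
    HasWeakPartial i (fun x => G (u x)) (fun x => G' (u x) * g i x) := by
  have hGu : MemLp (fun x => G (u x)) 2 volume := memLp_comp_of_abs_deriv_le_one hu hG hb h0
  have hG'g := memLp_comp_mul_of_abs_le_one hu.1 (hg2 i) hc hb
  refine ⟨hGu.locallyIntegrable (by norm_num), hG'g.locallyIntegrable (by norm_num),
    fun φ hφ hφc => ?_⟩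
  -- The classical chain rule holds for the smooth `w n`. In the limit, `G'(w) ∂w` splits into
  -- `G'(w) (∂w - g)`, which tends to zero in `L²` because `|G'| ≤ 1`, and `G'(w) g`. As `G'` is
  -- merely continuous, the latter needs dominated convergence along an almost everywhere convergent
  -- subsequence.
  obtain ⟨w, hw, hwu, hwg⟩ := exists_smooth_approx hu hg hg2
  have hGc : Continuous G := continuous_iff_continuousAt.2 fun t => (hG t).continuousAt
  have hwm : ∀ n, AEStronglyMeasurable (w n) volume :=
    fun n => (hw n).continuous.aestronglyMeasurable
  obtain ⟨ns, hns, hae⟩ := (tendstoInMeasure_of_tendsto_eLpNorm (by simp) hwm hu.1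
    hwu).exists_seq_tendsto_ae
  set e : Plane := EuclideanSpace.single i 1 with he
  have hφ1 : ContDiff ℝ 1 φ := hφ.of_le (by simp)
  have hdφc : Continuous fun x => fderiv ℝ φ x e :=
    (hφ1.continuous_fderiv (by simp)).clm_apply continuous_const
  have hdφs : HasCompactSupport fun x => fderiv ℝ φ x e := hφc.fderiv_apply (𝕜 := ℝ) e
  have hφ2 : MemLp φ 2 volume := hφ.continuous.memLp_of_hasCompactSupport hφc
  have hdφ2 : MemLp (fun x => fderiv ℝ φ x e) 2 volume := hdφc.memLp_of_hasCompactSupport hdφs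
  have hw1 : ∀ n, ContDiff ℝ 1 (w n) := fun n => (hw n).of_le (by simp)
  have hdw : ∀ n, Continuous fun x => fderiv ℝ (w n) x e := fun n =>
    ((hw1 n).continuous_fderiv (by simp)).clm_apply continuous_const
  have hdG : ∀ n x, HasFDerivAt (fun x => G (w n x)) (G' (w n x) • fderiv ℝ (w n) x) x :=
    fun n x => (hG (w n x)).comp_hasFDerivAt x ((hw1 n).differentiable (by simp) x).hasFDerivAt
  have hparts : ∀ n, ∫ x, G (w n x) * fderiv ℝ φ x e
      = - ∫ x, (G' (w n x) * fderiv ℝ (w n) x e) * φ x := by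
    intro n
    have hfd : ∀ x, fderiv ℝ (fun x => G (w n x)) x e = G' (w n x) * fderiv ℝ (w n) x e :=
      fun x => by rw [(hdG n x).fderiv]; simp
    have := integral_mul_fderiv_eq_neg_fderiv_mul_of_integrable (μ := volume)
      (f := fun x => G (w n x)) (g := φ) (v := e) ?_ ?_ ?_
      (fun x _ => (hdG n x).differentiableAt) (fun x _ => hφ1.differentiable (by simp) x)
    · simpa only [hfd] using this
    · simp only [hfd]
      exact (((hc.comp (hw n).continuous).mul (hdw n)).mul
        hφ.continuous).integrable_of_hasCompactSupport hφc.mul_left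
    · exact ((hGc.comp (hw n).continuous).mul hdφc).integrable_of_hasCompactSupport hdφs.mul_left
    · exact ((hGc.comp (hw n).continuous).mul hφ.continuous).integrable_of_hasCompactSupport
        hφc.mul_left
  have hwu' := hwu.comp hns.tendsto_atTop
  have hwg' := (hwg i).comp hns.tendsto_atTop
  have hlim1 : Tendsto (fun n => ∫ x, G (w (ns n) x) * fderiv ℝ φ x e) atTop
      (𝓝 (∫ x, G (u x) * fderiv ℝ φ x e)) := by
    refine tendsto_integral_mul_of_tendsto_eLpNorm
      (fun n => hGc.comp_aestronglyMeasurable (hwm _)) hGu hdφ2 ?_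
    refine tendsto_of_tendsto_of_tendsto_of_le_of_le tendsto_const_nhds hwu' (fun _ => zero_le)
      fun n => eLpNorm_mono fun x => ?_
    exact abs_sub_le_of_abs_deriv_le_one hG hb _ _
  have hlim2 : Tendsto (fun n => ∫ x, (G' (w (ns n) x) * (fderiv ℝ (w (ns n)) x e - g i x)) * φ x)
      atTop (𝓝 0) := by
    have := tendsto_integral_mul_of_tendsto_eLpNorm (A₀ := 0) (B := φ)
      (A := fun n x => G' (w (ns n) x) * (fderiv ℝ (w (ns n)) x e - g i x))
      (fun n => (hc.comp_aestronglyMeasurable (hwm _)).mul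
        ((hdw _).aestronglyMeasurable.sub (hg2 i).1)) MemLp.zero hφ2 ?_
    · simpa using this
    · refine tendsto_of_tendsto_of_tendsto_of_le_of_le tendsto_const_nhds hwg' (fun _ => zero_le)
        fun n => eLpNorm_mono fun x => ?_
      simp only [Pi.sub_apply, Pi.zero_apply, sub_zero, norm_mul]
      exact mul_le_of_le_one_left (norm_nonneg _) (hb _)
  have hgφ : Integrable (fun x => g i x * φ x) volume := (hg2 i).integrable_mul hφ2
  have hlim3 : Tendsto (fun n => ∫ x, G' (w (ns n) x) * (g i x * φ x)) atTop
      (𝓝 (∫ x, G' (u x) * (g i x * φ x))) := by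
    refine tendsto_integral_of_dominated_convergence (fun x => ‖g i x * φ x‖)
      (fun n => (hc.comp_aestronglyMeasurable (hwm _)).mul hgφ.1) hgφ.norm
      (fun n => ae_of_all _ fun x => ?_) ?_
    · rw [norm_mul]
      exact mul_le_of_le_one_left (norm_nonneg _) (hb _)
    · filter_upwards [hae] with x hx
      exact ((hc.tendsto _).comp hx).mul_const _
  have hint : ∀ n, Integrable (fun x => G' (w n x) * (g i x * φ x)) volume := fun n => by
    refine hgφ.mono ((hc.comp_aestronglyMeasurable (hwm _)).mul hgφ.1) (ae_of_all _ fun x => ?_)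
    rw [norm_mul]
    exact mul_le_of_le_one_left (norm_nonneg _) (hb _)
  have hsum : ∀ n, ∫ x, (G' (w n x) * fderiv ℝ (w n) x e) * φ x
      = (∫ x, (G' (w n x) * (fderiv ℝ (w n) x e - g i x)) * φ x)
        + ∫ x, G' (w n x) * (g i x * φ x) := by
    intro n
    have hi : Integrable (fun x => (G' (w n x) * fderiv ℝ (w n) x e) * φ x) volume :=
      (((hc.comp (hw n).continuous).mul (hdw n)).mul
        hφ.continuous).integrable_of_hasCompactSupport hφc.mul_left
    rw [← integral_add _ (hint n)]
    · refine integral_congr_ae (ae_of_all _ fun x => ?_)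
      ring
    · refine (hi.sub (hint n)).congr (ae_of_all _ fun x => ?_)
      simp only [Pi.sub_apply]
      ring
  have hlim4 : Tendsto (fun n => ∫ x, G (w (ns n) x) * fderiv ℝ φ x e) atTop
      (𝓝 (- (0 + ∫ x, G' (u x) * (g i x * φ x)))) := by
    simp only [hparts, hsum]
    exact (hlim2.add hlim3).neg
  rw [tendsto_nhds_unique hlim1 hlim4, zero_add]
  simp only [mul_assoc]

theorem MemH1.hasWeakPartial {u : Plane → ℝ} (hu : MemH1 u) (i : Fin 2) :
    HasWeakPartial i u (weakPartial i u) := by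
  obtain ⟨g, hg, -⟩ := hu.2 i
  have hex : ∃ g, HasWeakPartial i u g := ⟨g, hg⟩
  simp only [weakPartial, hex, dif_pos]
  exact hex.choose_spec

/-- `H` is stable under composition with functions whose derivative is bounded by one, and the
chain rule holds. -/
theorem MemH.comp {u : Plane → ℝ} (hu : MemH u) {G G' : ℝ → ℝ}
    (hG : ∀ t, HasDerivAt G (G' t) t) (hc : Continuous G') (hb : ∀ t, |G' t| ≤ 1)
    (h0 : G 0 = 0) :
    MemH (fun x => G (u x)) ∧
      (∀ i, weakPartial i (fun x => G (u x)) =ᵐ[volume] fun x => G' (u x) * weakPartial i u x) ∧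
      angularDeriv (fun x => G (u x)) =ᵐ[volume] fun x => G' (u x) * angularDeriv u x := by
  have hw : ∀ i, HasWeakPartial i u (weakPartial i u) := hu.1.hasWeakPartial
  have hw2 : ∀ i, MemLp (weakPartial i u) 2 volume := hu.1.memLp_weakPartial
  have hcomp := hasWeakPartial_comp hu.1.1 hw hw2 hG hc hb h0
  have hae := fun i => (hcomp i).weakPartial_ae_eq
  have hang : angularDeriv (fun x => G (u x)) =ᵐ[volume]
      fun x => G' (u x) * angularDeriv u x := by
    filter_upwards [hae 0, hae 1] with x h0 h1
    simp only [angularDeriv, h0, h1]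
    ring
  refine ⟨⟨⟨memLp_comp_of_abs_deriv_le_one hu.1.1 hG hb h0, fun i => ⟨_, hcomp i, ?_⟩⟩, ?_⟩,
    hae, hang⟩
  · exact memLp_comp_mul_of_abs_le_one hu.1.1.1 (hw2 i) hc hb
  · exact (memLp_congr_ae hang).2 (memLp_comp_mul_of_abs_le_one hu.1.1.1 hu.2 hc hb)

/-! ### Sobolev embedding into `L^q` for even `q` -/

theorem sq_lintegral_mul_le {α : Type*} [MeasurableSpace α] {μ : Measure α} {f g : α → ℝ≥0∞}
    (hf : AEMeasurable f μ) (hg : AEMeasurable g μ) :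
    (∫⁻ x, f x * g x ∂μ) ^ 2 ≤ (∫⁻ x, f x ^ 2 ∂μ) * ∫⁻ x, g x ^ 2 ∂μ := by
  have h := ENNReal.lintegral_mul_le_Lp_mul_Lq μ Real.HolderConjugate.two_two hf hg
  have h2 := pow_le_pow_left' h 2
  simp only [Pi.mul_apply, mul_pow, ENNReal.rpow_two] at h2
  simpa only [← ENNReal.rpow_two, ← ENNReal.rpow_mul, one_div, inv_mul_cancel₀ (two_ne_zero' ℝ),
    ENNReal.rpow_one] using h2

/-- The sum of the `L²` norms of a function and of two further functions, in applications its
partial derivatives. -/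
def sumNorm (u : Plane → ℝ) (g : Fin 2 → Plane → ℝ) : ℝ≥0∞ :=
  eLpNorm u 2 volume + (eLpNorm (g 0) 2 volume + eLpNorm (g 1) 2 volume)

/-- This links the operator norm of the derivative in the Gagliardo–Nirenberg–Sobolev inequality to
the coordinate derivatives in `sumNorm`. -/
theorem norm_clm_le (L : Plane →L[ℝ] ℝ) :
    ‖L‖ ≤ ‖L (EuclideanSpace.single 0 1)‖ + ‖L (EuclideanSpace.single 1 1)‖ := by
  refine L.opNorm_le_bound (by positivity) fun v => ?_
  have hv : v = v 0 • EuclideanSpace.single 0 (1 : ℝ) + v 1 • EuclideanSpace.single 1 (1 : ℝ) := by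
    ext i
    fin_cases i <;> simp
  have h0 : ‖v 0‖ ≤ ‖v‖ := PiLp.norm_apply_le v 0
  have h1 : ‖v 1‖ ≤ ‖v‖ := PiLp.norm_apply_le v 1
  calc ‖L v‖ = ‖v 0 * L (EuclideanSpace.single 0 1) + v 1 * L (EuclideanSpace.single 1 1)‖ := by
        conv_lhs => rw [hv]
        simp only [map_add, map_smul, smul_eq_mul]
    _ ≤ ‖v 0‖ * ‖L (EuclideanSpace.single 0 1)‖ + ‖v 1‖ * ‖L (EuclideanSpace.single 1 1)‖ := by
        refine (norm_add_le _ _).trans (le_of_eq ?_)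
        rw [norm_mul, norm_mul]
    _ ≤ _ := by
        rw [add_mul, mul_comm ‖L (EuclideanSpace.single 0 1)‖,
          mul_comm ‖L (EuclideanSpace.single 1 1)‖]
        gcongr

theorem lintegral_enorm_sq_eq {F : Type*} [NormedAddCommGroup F] (f : Plane → F) :
    ∫⁻ x, ‖f x‖ₑ ^ 2 = eLpNorm f 2 volume ^ 2 := by
  rw [eLpNorm_eq_lintegral_rpow_enorm_toReal (by simp) (by simp), ← ENNReal.rpow_two,
    ← ENNReal.rpow_mul]
  simp

/-- One step of the Sobolev bootstrap: the Gagliardo–Nirenberg–Sobolev inequality for `φ ^ m`. -/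
theorem exists_lintegral_pow_succ_le (m : ℕ) :
    ∃ K : ℝ≥0∞, K ≠ ⊤ ∧ ∀ φ : Plane → ℝ, ContDiff ℝ ∞ φ → HasCompactSupport φ →
      ∫⁻ x, ‖φ x‖ₑ ^ (2 * (m + 1))
        ≤ K * ((∫⁻ x, ‖φ x‖ₑ ^ (2 * m)) * ∫⁻ x, ‖fderiv ℝ φ x‖ₑ ^ 2) := by
  have hfr : (Module.finrank ℝ Plane : ℝ) = 2 := by simp
  have hconj : Real.HolderConjugate (Module.finrank ℝ Plane : ℝ) 2 := by
    rw [hfr]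
    exact Real.HolderConjugate.two_two
  set c : ℝ≥0∞ := (lintegralPowLePowLIntegralFDerivConst (volume : Measure Plane) 2 : ℝ≥0∞) with hcdef
  refine ⟨c * ((m : ℝ≥0∞) + 1) ^ 2, by finiteness, fun φ hφ hc => ?_⟩
  have hφ1 : ContDiff ℝ 1 φ := hφ.of_le (by simp)
  -- In dimension two this is the embedding of `W^{1,1}` into `L²`; the gradient of `φ ^ (m + 1)` is
  -- then split by Cauchy–Schwarz into `φ ^ m` and the gradient of `φ`.
  have hgns := lintegral_pow_le_pow_lintegral_fderiv (volume : Measure Plane)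
    (u := fun x => φ x ^ (m + 1)) (hφ1.pow _)
    (hc.comp_left (g := fun t : ℝ => t ^ (m + 1)) (by simp)) hconj
  have hfd : ∀ x, ‖fderiv ℝ (fun x => φ x ^ (m + 1)) x‖ₑ
      = ((m : ℝ≥0∞) + 1) * (‖φ x‖ₑ ^ m * ‖fderiv ℝ φ x‖ₑ) := by
    intro x
    have := ((hφ1.differentiable (by simp) x).hasFDerivAt.pow (m + 1))
    rw [this.fderiv]
    simp only [add_tsub_cancel_right, enorm_smul, enorm_mul, enorm_pow, nsmul_eq_mul]
    rw [mul_assoc]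
    congr 1
    rw [Real.enorm_natCast]
    push_cast
    rfl
  have hm1 : AEMeasurable (fun x => ‖φ x‖ₑ ^ m) volume :=
    (hφ.continuous.enorm.measurable.pow_const m).aemeasurable
  have hm2 : AEMeasurable (fun x => ‖fderiv ℝ φ x‖ₑ) volume :=
    (hφ1.continuous_fderiv (by simp)).enorm.measurable.aemeasurable
  have hcs := sq_lintegral_mul_le hm1 hm2
  simp only [hfd, ENNReal.rpow_two] at hgns
  rw [lintegral_const_mul' _ _ (by finiteness), mul_pow] at hgns
  calc ∫⁻ x, ‖φ x‖ₑ ^ (2 * (m + 1)) = ∫⁻ x, ‖φ x ^ (m + 1)‖ₑ ^ 2 := by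
        refine lintegral_congr fun x => ?_
        rw [enorm_pow, ← pow_mul, mul_comm]
    _ ≤ _ := hgns
    _ ≤ c * (((m : ℝ≥0∞) + 1) ^ 2 * ((∫⁻ x, (‖φ x‖ₑ ^ m) ^ 2) * ∫⁻ x, ‖fderiv ℝ φ x‖ₑ ^ 2)) := by
        gcongr
    _ = _ := by
        rw [mul_assoc]
        simp only [← pow_mul, mul_comm m 2]

/-- The Sobolev inequality for test functions. -/
theorem exists_sobolev_testFunction (m : ℕ) :
    ∃ K : ℝ≥0∞, K ≠ ⊤ ∧ ∀ φ : Plane → ℝ, ContDiff ℝ ∞ φ → HasCompactSupport φ →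
      ∫⁻ x, ‖φ x‖ₑ ^ (2 * (m + 1))
        ≤ K * sumNorm φ (fun i x => fderiv ℝ φ x (EuclideanSpace.single i 1)) ^ (2 * (m + 1)) := by
  induction m with
  | zero =>
    refine ⟨1, by simp, fun φ _ _ => ?_⟩
    rw [zero_add, mul_one, lintegral_enorm_sq_eq, one_mul]
    exact pow_le_pow_left' le_self_add 2
  | succ m ih =>
    obtain ⟨K, hK, h⟩ := ih
    obtain ⟨K', hK', h'⟩ := exists_lintegral_pow_succ_le (m + 1)
    refine ⟨K' * K, by finiteness, fun φ hφ hc => ?_⟩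
    have hφ1 : ContDiff ℝ 1 φ := hφ.of_le (by simp)
    have hm : ∀ i : Fin 2, AEStronglyMeasurable
        (fun x => fderiv ℝ φ x (EuclideanSpace.single i 1)) volume := fun i =>
      ((hφ1.continuous_fderiv (by simp)).clm_apply continuous_const).aestronglyMeasurable
    set S := sumNorm φ (fun i x => fderiv ℝ φ x (EuclideanSpace.single i 1)) with hS
    have hD : ∫⁻ x, ‖fderiv ℝ φ x‖ₑ ^ 2 ≤ S ^ 2 := by
      rw [lintegral_enorm_sq_eq]
      refine pow_le_pow_left' ?_ 2
      calc eLpNorm (fderiv ℝ φ) 2 volume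
          ≤ eLpNorm ((fun x => ‖fderiv ℝ φ x (EuclideanSpace.single 0 1)‖)
            + fun x => ‖fderiv ℝ φ x (EuclideanSpace.single 1 1)‖) 2 volume :=
            eLpNorm_mono_real fun x => norm_clm_le _
        _ ≤ _ := eLpNorm_add_le (hm 0).norm (hm 1).norm (by norm_num)
        _ ≤ S := by
          rw [eLpNorm_norm, eLpNorm_norm, hS, sumNorm]
          exact le_add_self
    calc _ ≤ _ := h' φ hφ hc
      _ ≤ K' * ((K * S ^ (2 * (m + 1))) * S ^ 2) := by
        gcongr
        exact h φ hφ hc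
      _ = _ := by ring

/-- A smooth cut-off function. -/
def cutoff : ContDiffBump (0 : Plane) where
  rIn := 1
  rOut := 2
  rIn_pos := one_pos
  rIn_lt_rOut := one_lt_two

/-- The Sobolev inequality for functions with square integrable weak derivatives. -/
theorem exists_sobolev (m : ℕ) :
    ∃ K : ℝ≥0∞, K ≠ ⊤ ∧ ∀ (u : Plane → ℝ) (g : Fin 2 → Plane → ℝ), MemLp u 2 volume →
      (∀ i, HasWeakPartial i u (g i)) → (∀ i, MemLp (g i) 2 volume) →
      ∫⁻ x, ‖u x‖ₑ ^ (2 * (m + 1)) ≤ K * sumNorm u g ^ (2 * (m + 1)) := by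
  obtain ⟨K, hK, hsob⟩ := exists_sobolev_testFunction m
  have hχ1 : ContDiff ℝ 1 (cutoff : Plane → ℝ) := cutoff.contDiff
  obtain ⟨M, hM⟩ := (hχ1.continuous_fderiv (by simp)).bounded_above_of_compact_support
    (cutoff.hasCompactSupport.fderiv ℝ)
  have hM0 : 0 ≤ M := (norm_nonneg _).trans (hM 0)
  set M' : ℝ≥0∞ := ENNReal.ofReal M with hM'
  -- Each of the two partial derivatives of a cut-off function costs at most `M'` times the `L²`
  -- norm, by the product rule.
  refine ⟨K * (1 + 2 * M') ^ (2 * (m + 1)), by finiteness, fun u g hu hg hg2 => ?_⟩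
  obtain ⟨w, hw, hwu, hwg⟩ := exists_smooth_approx hu hg hg2
  have hwm : ∀ n, AEStronglyMeasurable (w n) volume :=
    fun n => (hw n).continuous.aestronglyMeasurable
  obtain ⟨ns, hns, hae⟩ := (tendstoInMeasure_of_tendsto_eLpNorm (by simp) hwm hu.1
    hwu).exists_seq_tendsto_ae
  -- Dilated cut-offs make the approximations compactly supported. Their gradients need only stay
  -- bounded, since a loss in the constant is harmless.
  let c : ℕ → ℝ := fun n => 1 / ((n : ℝ) + 1)
  have hc0 : ∀ n, 0 < c n := fun n => by positivity
  have hc1 : ∀ n, c n ≤ 1 := fun n => by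
    rw [div_le_one (by positivity)]
    linarith [(Nat.cast_nonneg n : (0 : ℝ) ≤ n)]
  have hclim : Tendsto c atTop (𝓝 0) := tendsto_one_div_add_atTop_nhds_zero_nat
  let χ : ℕ → Plane → ℝ := fun n x => cutoff (c n • x)
  have hχs : ∀ n, ContDiff ℝ ∞ (χ n) := fun n =>
    cutoff.contDiff.comp (contDiff_const_smul (c n))
  have hχc : ∀ n, HasCompactSupport (χ n) := fun n =>
    cutoff.hasCompactSupport.comp_smul (hc0 n).ne'
  have hχle : ∀ n x, ‖χ n x‖ ≤ 1 := fun n x => by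
    rw [Real.norm_of_nonneg cutoff.nonneg]
    exact cutoff.le_one
  have hχd : ∀ n x, ‖fderiv ℝ (χ n) x‖ ≤ M := fun n x => by
    have h1 : HasFDerivAt (fun x : Plane => c n • x) (c n • ContinuousLinearMap.id ℝ Plane) x :=
      (hasFDerivAt_id x).const_smul (c n)
    have h2 := (hχ1.differentiable (by simp) (c n • x)).hasFDerivAt.comp x h1
    have h3 : HasFDerivAt (χ n) _ x := h2
    rw [h3.fderiv]
    have : (fderiv ℝ (cutoff : Plane → ℝ) (c n • x)).comp (c n • ContinuousLinearMap.id ℝ Plane)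
        = c n • fderiv ℝ (cutoff : Plane → ℝ) (c n • x) := by
      ext v
      simp
    rw [this, norm_smul, Real.norm_of_nonneg (hc0 n).le]
    exact (mul_le_of_le_one_left (norm_nonneg _) (hc1 n)).trans (hM _)
  have hχlim : ∀ x, Tendsto (fun n => χ n x) atTop (𝓝 1) := fun x => by
    have h1 : Tendsto (fun n => c n • x) atTop (𝓝 0) := by
      simpa using hclim.smul_const x
    have h2 := (cutoff.continuous.tendsto 0).comp h1
    have h3 : (cutoff : Plane → ℝ) 0 = 1 :=
      cutoff.one_of_mem_closedBall (Metric.mem_closedBall_self cutoff.rIn_pos.le)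
    rwa [h3] at h2
  let ψ : ℕ → Plane → ℝ := fun n x => χ n x * w n x
  have hψs : ∀ n, ContDiff ℝ ∞ (ψ n) := fun n => (hχs n).mul (hw n)
  have hψc : ∀ n, HasCompactSupport (ψ n) := fun n => (hχc n).mul_right
  have hw1 : ∀ n, ContDiff ℝ 1 (w n) := fun n => (hw n).of_le (by simp)
  have hdw : ∀ n (i : Fin 2), Continuous fun x => fderiv ℝ (w n) x (EuclideanSpace.single i 1) :=
    fun n i => ((hw1 n).continuous_fderiv (by simp)).clm_apply continuous_const
  have hψle : ∀ n, eLpNorm (ψ n) 2 volume ≤ eLpNorm (w n) 2 volume := fun n =>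
    eLpNorm_mono fun x => by
      rw [norm_mul]
      exact mul_le_of_le_one_left (norm_nonneg _) (hχle n x)
  have hψdle : ∀ n (i : Fin 2),
      eLpNorm (fun x => fderiv ℝ (ψ n) x (EuclideanSpace.single i 1)) 2 volume
      ≤ eLpNorm (fun x => fderiv ℝ (w n) x (EuclideanSpace.single i 1)) 2 volume
        + M' * eLpNorm (w n) 2 volume := by
    intro n i
    have h1 : ∀ x, fderiv ℝ (ψ n) x (EuclideanSpace.single i 1)
        = χ n x * fderiv ℝ (w n) x (EuclideanSpace.single i 1)
          + w n x * fderiv ℝ (χ n) x (EuclideanSpace.single i 1) := fun x => by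
      have := (((hχs n).differentiable (by simp) x).hasFDerivAt).mul
        (((hw n).differentiable (by simp) x).hasFDerivAt)
      have h' : HasFDerivAt (ψ n) _ x := this
      rw [h'.fderiv]
      simp
    have h2 : ∀ x, ‖fderiv ℝ (χ n) x (EuclideanSpace.single i 1)‖ ≤ M := fun x => by
      refine ((fderiv ℝ (χ n) x).le_opNorm _).trans ?_
      simpa using hχd n x
    calc _ ≤ eLpNorm ((fun x => ‖fderiv ℝ (w n) x (EuclideanSpace.single i 1)‖)
          + fun x => ‖M * w n x‖) 2 volume := by
          refine eLpNorm_mono_real fun x => ?_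
          rw [h1]
          refine (norm_add_le _ _).trans ?_
          simp only [norm_mul, Pi.add_apply, Real.norm_of_nonneg hM0]
          refine add_le_add (mul_le_of_le_one_left (norm_nonneg _) (hχle n x)) ?_
          rw [mul_comm]
          exact mul_le_mul_of_nonneg_right (h2 x) (norm_nonneg _)
      _ ≤ _ := eLpNorm_add_le (hdw n i).aestronglyMeasurable.norm
          ((hwm n).const_mul M).norm (by norm_num)
      _ = _ := by
          rw [eLpNorm_norm, eLpNorm_norm]
          congr 1
          have := eLpNorm_const_smul M (w n) 2 (volume : Measure Plane)
          rw [Real.enorm_of_nonneg hM0] at this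
          exact this
  have hsum : ∀ n, sumNorm (ψ n) (fun i x => fderiv ℝ (ψ n) x (EuclideanSpace.single i 1))
      ≤ (1 + 2 * M') * sumNorm (w n) (fun i x => fderiv ℝ (w n) x (EuclideanSpace.single i 1)) := by
    intro n
    unfold sumNorm
    calc _ ≤ eLpNorm (w n) 2 volume + ((eLpNorm (fun x => fderiv ℝ (w n) x
            (EuclideanSpace.single 0 1)) 2 volume + M' * eLpNorm (w n) 2 volume)
          + (eLpNorm (fun x => fderiv ℝ (w n) x
            (EuclideanSpace.single 1 1)) 2 volume + M' * eLpNorm (w n) 2 volume)) :=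
          add_le_add (hψle n) (add_le_add (hψdle n 0) (hψdle n 1))
      _ ≤ _ := by
          generalize eLpNorm (w n) 2 volume = a
          generalize eLpNorm (fun x => fderiv ℝ (w n) x (EuclideanSpace.single 0 1)) 2 volume = b
          generalize eLpNorm (fun x => fderiv ℝ (w n) x (EuclideanSpace.single 1 1)) 2 volume = d
          calc _ = (a + (b + d)) + 2 * M' * a := by ring
            _ ≤ (a + (b + d)) + 2 * M' * (a + (b + d)) := by
              gcongr
              exact le_self_add
            _ = _ := by ring
  have hub : ∀ n, sumNorm (w n) (fun i x => fderiv ℝ (w n) x (EuclideanSpace.single i 1))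
      ≤ sumNorm (w n - u) (fun i => (fun x => fderiv ℝ (w n) x (EuclideanSpace.single i 1)) - g i)
        + sumNorm u g := by
    intro n
    have tri : ∀ f h : Plane → ℝ, AEStronglyMeasurable f volume → AEStronglyMeasurable h volume →
        eLpNorm f 2 volume ≤ eLpNorm (f - h) 2 volume + eLpNorm h 2 volume := fun f h hf hh => by
      have := eLpNorm_add_le (hf.sub hh) hh (p := 2) (by norm_num)
      simpa using this
    unfold sumNorm
    calc _ ≤ _ := add_le_add (tri _ u (hwm n) hu.1) (add_le_add
            (tri _ (g 0) (hdw n 0).aestronglyMeasurable (hg2 0).1)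
            (tri _ (g 1) (hdw n 1).aestronglyMeasurable (hg2 1).1))
      _ = _ := by ring
  have hublim : Tendsto (fun n => sumNorm (w n - u)
      (fun i => (fun x => fderiv ℝ (w n) x (EuclideanSpace.single i 1)) - g i)
        + sumNorm u g) atTop (𝓝 (sumNorm u g)) := by
    have h1 := hwu.add ((hwg 0).add (hwg 1))
    have h2 := h1.add_const (sumNorm u g)
    rw [add_zero, add_zero, zero_add] at h2
    exact h2
  have hfin : sumNorm u g ≠ ⊤ := by
    have h0 := (hg2 0).2.ne
    have h1 := (hg2 1).2.ne
    have h2 := hu.2.ne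
    unfold sumNorm
    finiteness
  have hlim : Tendsto (fun n => K * ((1 + 2 * M') * (sumNorm (w n - u)
      (fun i => (fun x => fderiv ℝ (w n) x (EuclideanSpace.single i 1)) - g i)
        + sumNorm u g)) ^ (2 * (m + 1))) atTop
      (𝓝 (K * ((1 + 2 * M') * sumNorm u g) ^ (2 * (m + 1)))) := by
    refine ENNReal.Tendsto.const_mul ?_ (Or.inr hK)
    refine ENNReal.Tendsto.pow ?_
    exact ENNReal.Tendsto.const_mul hublim (Or.inr (by finiteness))
  have hbd : ∀ n, ∫⁻ x, ‖ψ n x‖ₑ ^ (2 * (m + 1)) ≤ K * ((1 + 2 * M') * (sumNorm (w n - u)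
      (fun i => (fun x => fderiv ℝ (w n) x (EuclideanSpace.single i 1)) - g i)
        + sumNorm u g)) ^ (2 * (m + 1)) := fun n => by
    refine (hsob (ψ n) (hψs n) (hψc n)).trans ?_
    gcongr
    refine (hsum n).trans ?_
    gcongr
    exact hub n
  -- Fatou's lemma needs only the almost everywhere convergence of `ψ (ns n)` to `u`.
  calc ∫⁻ x, ‖u x‖ₑ ^ (2 * (m + 1))
      = ∫⁻ x, liminf (fun n => ‖ψ (ns n) x‖ₑ ^ (2 * (m + 1))) atTop := by
        refine lintegral_congr_ae ?_
        filter_upwards [hae] with x hx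
        have h1 : Tendsto (fun n => ψ (ns n) x) atTop (𝓝 (1 * u x)) :=
          ((hχlim x).comp hns.tendsto_atTop).mul hx
        rw [one_mul] at h1
        exact (ENNReal.Tendsto.pow h1.enorm).liminf_eq.symm
    _ ≤ liminf (fun n => ∫⁻ x, ‖ψ (ns n) x‖ₑ ^ (2 * (m + 1))) atTop :=
        lintegral_liminf_le fun n => (hψs _).continuous.enorm.measurable.pow_const _
    _ ≤ liminf (fun n => K * ((1 + 2 * M') * (sumNorm (w (ns n) - u)
        (fun i => (fun x => fderiv ℝ (w (ns n)) x (EuclideanSpace.single i 1)) - g i)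
        + sumNorm u g)) ^ (2 * (m + 1))) atTop :=
        liminf_le_liminf (Eventually.of_forall fun n => hbd (ns n))
    _ = K * ((1 + 2 * M') * sumNorm u g) ^ (2 * (m + 1)) :=
        (hlim.comp hns.tendsto_atTop).liminf_eq
    _ = _ := by rw [mul_pow, mul_assoc]

theorem MemH1.integrable_normH1_integrand {u : Plane → ℝ} (hu : MemH1 u) :
    Integrable (fun x => (∑ i : Fin 2, weakPartial i u x ^ 2) + u x ^ 2) volume :=
  (integrable_finsetSum _ fun i _ => (hu.memLp_weakPartial i).integrable_sq).add
    hu.1.integrable_sq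

theorem normH1_sq (u : Plane → ℝ) :
    normH1 u ^ 2 = ∫ x, ((∑ i : Fin 2, weakPartial i u x ^ 2) + u x ^ 2) :=
  Real.sq_sqrt (integral_nonneg fun x => by positivity)

theorem MemH1.integral_sq_le {u : Plane → ℝ} (hu : MemH1 u) :
    ∫ x, u x ^ 2 ≤ normH1 u ^ 2 := by
  rw [normH1_sq]
  refine integral_mono hu.1.integrable_sq hu.integrable_normH1_integrand fun x => ?_
  exact le_add_of_nonneg_left (Finset.sum_nonneg fun i _ => sq_nonneg _)

theorem MemH1.integral_weakPartial_sq_le {u : Plane → ℝ} (hu : MemH1 u) (i : Fin 2) :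
    ∫ x, weakPartial i u x ^ 2 ≤ normH1 u ^ 2 := by
  rw [normH1_sq]
  refine integral_mono (hu.memLp_weakPartial i).integrable_sq hu.integrable_normH1_integrand
    fun x => ?_
  exact (Finset.single_le_sum (f := fun i => weakPartial i u x ^ 2) (fun i _ => sq_nonneg _)
    (Finset.mem_univ i)).trans (le_add_of_nonneg_right (sq_nonneg _))

theorem eLpNorm_two_le_of_integral_sq_le {f : Plane → ℝ} (hf : MemLp f 2 volume) {N : ℝ}
    (hN : 0 ≤ N) (h : ∫ x, f x ^ 2 ≤ N ^ 2) : eLpNorm f 2 volume ≤ ENNReal.ofReal N := by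
  rw [← ENNReal.pow_le_pow_left_iff two_ne_zero, ← lintegral_enorm_sq_eq, ← ENNReal.ofReal_pow hN]
  refine le_trans (le_of_eq ?_) (ENNReal.ofReal_le_ofReal h)
  rw [ofReal_integral_eq_lintegral_ofReal hf.integrable_sq (ae_of_all _ fun x => sq_nonneg _)]
  refine lintegral_congr fun x => ?_
  rw [← sq_abs, ENNReal.ofReal_pow (abs_nonneg _), Real.enorm_eq_ofReal_abs]

theorem normH1_nonneg (u : Plane → ℝ) : 0 ≤ normH1 u := Real.sqrt_nonneg _

/-- The Sobolev embedding of `H¹(ℝ²)` into `L^q(ℝ²)` for even `q`. -/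
theorem exists_integral_pow_le (m : ℕ) :
    ∃ K : ℝ, 0 < K ∧ ∀ u : Plane → ℝ, MemH1 u →
      Integrable (fun x => u x ^ (2 * (m + 1))) volume ∧
      ∫ x, u x ^ (2 * (m + 1)) ≤ K * normH1 u ^ (2 * (m + 1)) := by
  obtain ⟨K, hK, hs⟩ := exists_sobolev m
  -- The `3` counts the terms of `sumNorm`, each at most the `H¹` norm; the `+ 1` keeps the constant
  -- positive.
  refine ⟨(K.toReal + 1) * 3 ^ (2 * (m + 1)), by positivity, fun u hu => ?_⟩
  have hN := normH1_nonneg u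
  have h1 := hs u (fun i => weakPartial i u) hu.1 hu.hasWeakPartial hu.memLp_weakPartial
  have h2 : sumNorm u (fun i => weakPartial i u) ≤ ENNReal.ofReal (3 * normH1 u) := by
    unfold sumNorm
    rw [show 3 * normH1 u = normH1 u + (normH1 u + normH1 u) by ring,
      ENNReal.ofReal_add hN (by positivity), ENNReal.ofReal_add hN hN]
    exact add_le_add (eLpNorm_two_le_of_integral_sq_le hu.1 hN hu.integral_sq_le)
      (add_le_add (eLpNorm_two_le_of_integral_sq_le (hu.memLp_weakPartial 0) hN
        (hu.integral_weakPartial_sq_le 0)) (eLpNorm_two_le_of_integral_sq_le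
          (hu.memLp_weakPartial 1) hN (hu.integral_weakPartial_sq_le 1)))
  have h3 : ∫⁻ x, ‖u x ^ (2 * (m + 1))‖ₑ
      ≤ ENNReal.ofReal (K.toReal * (3 * normH1 u) ^ (2 * (m + 1))) := by
    simp only [enorm_pow]
    rw [ENNReal.ofReal_mul ENNReal.toReal_nonneg, ENNReal.ofReal_toReal hK,
      ENNReal.ofReal_pow (by positivity)]
    exact h1.trans (by gcongr)
  refine ⟨⟨hu.1.1.pow _, h3.trans_lt ENNReal.ofReal_lt_top⟩, ?_⟩
  have hnn : ∀ x, 0 ≤ u x ^ (2 * (m + 1)) := fun x => (even_two_mul _).pow_nonneg _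
  have h4 : ENNReal.ofReal (∫ x, u x ^ (2 * (m + 1)))
      ≤ ENNReal.ofReal (K.toReal * (3 * normH1 u) ^ (2 * (m + 1))) := by
    refine le_trans (le_trans ?_ (enorm_integral_le_lintegral_enorm _)) h3
    rw [Real.enorm_of_nonneg (integral_nonneg hnn)]
  rw [ENNReal.ofReal_le_ofReal_iff (by positivity)] at h4
  refine h4.trans ?_
  rw [mul_pow, ← mul_assoc]
  gcongr
  linarith

/-! ### Truncation, level iteration and Cauchy–Schwarz on a set -/

/-- A continuously differentiable odd truncation: it vanishes on `[-k, k]` and is comparable to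
the identity away from `[-h, h]`. -/
theorem exists_truncation {k h : ℝ} (hk : 0 ≤ k) (hkh : k < h) :
    ∃ G G' : ℝ → ℝ, (∀ t, HasDerivAt G (G' t) t) ∧ Continuous G' ∧ (∀ t, 0 ≤ G' t) ∧
      (∀ t, G' t ≤ 1) ∧ G 0 = 0 ∧ (∀ t, |t| ≤ k → G t = 0) ∧ (∀ t, G t ^ 2 ≤ t * G t) ∧
      ∀ t, h ≤ |t| → (h - k) / 4 ≤ |G t| := by
  have hd : 0 < h - k := sub_pos.2 hkh
  -- The slope ramps linearly from `0` at `|t| = k` to `1` at `|t| = h`, so that `G` is `C¹` as the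
  -- chain rule requires; the usual `(|t| - k)₊` is not.
  let G' : ℝ → ℝ := fun t => max 0 (min 1 ((|t| - k) / (h - k)))
  let G : ℝ → ℝ := fun t => ∫ s in (0 : ℝ)..t, G' s
  have hc : Continuous G' := by fun_prop
  have h0 : ∀ t, 0 ≤ G' t := fun t => le_max_left _ _
  have h1 : ∀ t, G' t ≤ 1 := fun t => max_le zero_le_one (min_le_left _ _)
  have hG : ∀ t, HasDerivAt G (G' t) t := fun t => (hc.integral_hasStrictDerivAt 0 t).hasDerivAt
  have hG0 : G 0 = 0 := intervalIntegral.integral_same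
  have hb : ∀ t, |G' t| ≤ 1 := fun t => by rw [abs_of_nonneg (h0 t)]; exact h1 t
  have hodd : ∀ t, G (-t) = - G t := fun t => by
    have e : ∫ s in (0 : ℝ)..t, G' (-s) = ∫ s in (-t)..(-0), G' s :=
      intervalIntegral.integral_comp_neg G'
    have e' : ∀ s, G' (-s) = G' s := fun s => by simp only [G', abs_neg]
    simp only [e', neg_zero] at e
    change ∫ s in (0 : ℝ)..(-t), G' s = - ∫ s in (0 : ℝ)..t, G' s
    rw [e, intervalIntegral.integral_symm]
  have hmono : Monotone G := monotone_of_hasDerivAt_nonneg hG h0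
  have hz : ∀ t, 0 ≤ t → t ≤ k → G t = 0 := fun t ht htk => by
    change ∫ s in (0 : ℝ)..t, G' s = 0
    rw [intervalIntegral.integral_congr (g := fun _ => (0 : ℝ)) (fun s hs => ?_)]
    · simp
    · rw [Set.uIcc_of_le ht] at hs
      refine max_eq_left ((min_le_right _ _).trans ?_)
      refine div_nonpos_of_nonpos_of_nonneg ?_ hd.le
      rw [abs_of_nonneg hs.1]
      linarith [hs.2]
  have hlow : ∀ t, h ≤ t → (h - k) / 4 ≤ G t := fun t ht => by
    -- Beyond the midpoint the slope is at least `1 / 2`, over a length `(h - k) / 2`.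
    set c := (h + k) / 2 with hcdef
    have hGc : 0 ≤ G c := by
      rw [← hG0]
      exact hmono (by linarith)
    have hsub : G h - G c = ∫ s in c..h, G' s :=
      intervalIntegral.integral_interval_sub_left (hc.intervalIntegrable _ _)
        (hc.intervalIntegrable _ _)
    have hge : ∫ s in c..h, (1 / 2 : ℝ) ≤ ∫ s in c..h, G' s := by
      refine intervalIntegral.integral_mono_on (by linarith) intervalIntegrable_const
        (hc.intervalIntegrable _ _) fun s hs => ?_
      refine le_max_of_le_right (le_min (by norm_num) ?_)
      rw [le_div_iff₀ hd, abs_of_nonneg (by linarith [hs.1])]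
      linarith [hs.1]
    rw [intervalIntegral.integral_const, smul_eq_mul] at hge
    have := hmono ht
    linarith
  have hpos : ∀ t, 0 ≤ t → 0 ≤ G t := fun t ht => by
    rw [← hG0]
    exact hmono ht
  have hle : ∀ t, 0 ≤ t → G t ≤ t := fun t ht => by
    have := abs_sub_le_of_abs_deriv_le_one hG hb t 0
    rw [hG0, sub_zero, sub_zero, abs_of_nonneg ht] at this
    exact (le_abs_self _).trans this
  refine ⟨G, G', hG, hc, h0, h1, hG0, fun t ht => ?_, fun t => ?_, fun t ht => ?_⟩
  · rcases le_total 0 t with h | h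
    · exact hz t h (by rwa [abs_of_nonneg h] at ht)
    · have := hz (-t) (by linarith) (by rwa [abs_of_nonpos h] at ht)
      rw [hodd] at this
      linarith
  · rcases le_total 0 t with h | h
    · nlinarith [hpos t h, hle t h]
    · have h1 := hpos (-t) (by linarith)
      have h2 := hle (-t) (by linarith)
      rw [hodd] at h1 h2
      nlinarith
  · rcases le_total 0 t with h | h
    · rw [abs_of_nonneg h] at ht
      exact (hlow t ht).trans (le_abs_self _)
    · rw [abs_of_nonpos h] at ht
      have := hlow (-t) ht
      rw [hodd] at this
      exact this.trans (neg_le_abs _)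

/-- Stampacchia's iteration lemma. -/
theorem eq_zero_of_level_decay {a : ℝ → ℝ} (ha : Antitone a) (hnn : ∀ k, 0 ≤ a k) {k₀ D : ℝ}
    (hD : 0 < D) (h₀ : a k₀ ≤ 1)
    (h : ∀ k h, k₀ ≤ k → k < h → (h - k) ^ 8 * a h ≤ D ^ 8 * a k ^ 2) :
    a (k₀ + 4 * D) = 0 := by
  -- With `r = 2⁻ⁿ` the gap between consecutive levels is `2 D r`, and `a (k n) ≤ r⁸` propagates
  -- since `D⁸ r¹⁶ / (2 D r)⁸ = (r / 2)⁸`; this fixes the factor `4`.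
  let k : ℕ → ℝ := fun n => k₀ + 4 * D * (1 - (1 / 2) ^ n)
  have hbd : ∀ n, a (k n) ≤ ((1 / 2 : ℝ) ^ n) ^ 8 := by
    intro n
    induction n with
    | zero => simpa [k] using h₀
    | succ n ih =>
      set r : ℝ := (1 / 2 : ℝ) ^ n with hr
      have hr0 : 0 < r := by positivity
      have hr1 : r ≤ 1 := pow_le_one₀ (by norm_num) (by norm_num)
      have hkn : k (n + 1) - k n = 2 * D * r := by
        simp only [k, pow_succ, ← hr]
        ring
      have := h (k n) (k (n + 1)) (by
        have : 0 ≤ 4 * D * (1 - r) := mul_nonneg (by positivity) (by linarith)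
        simp only [k, ← hr]
        linarith) (by
        have : 0 < 2 * D * r := by positivity
        linarith)
      rw [hkn] at this
      have h3 : a (k n) ^ 2 ≤ (r ^ 8) ^ 2 := by
        have := hnn (k n)
        gcongr
      have h4 : (2 * D * r) ^ 8 * a (k (n + 1)) ≤ (2 * D * r) ^ 8 * (r / 2) ^ 8 := by
        refine this.trans ((mul_le_mul_of_nonneg_left h3 (by positivity)).trans (le_of_eq ?_))
        ring
      have h5 := le_of_mul_le_mul_left h4 (by positivity)
      rwa [pow_succ (1 / 2 : ℝ) n, ← hr, mul_one_div]
  refine le_antisymm ?_ (hnn _)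
  have hlim : Tendsto (fun n : ℕ => ((1 / 2 : ℝ) ^ n) ^ 8) atTop (𝓝 0) := by
    simpa using (tendsto_pow_atTop_nhds_zero_of_lt_one (r := (1 / 2 : ℝ)) (by norm_num)
      (by norm_num)).pow 8
  refine ge_of_tendsto' hlim fun n => (ha ?_).trans (hbd n)
  have : 0 ≤ 4 * D * (1 / 2 : ℝ) ^ n := by positivity
  simp only [k]
  linarith

/-- The Cauchy–Schwarz inequality against an indicator function. -/
theorem sq_setIntegral_le {α : Type*} [MeasurableSpace α] {μ : Measure α} {s : Set α}
    (hs : μ s ≠ ⊤) {f : α → ℝ} (hf : IntegrableOn f s μ)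
    (hf2 : IntegrableOn (fun x => f x ^ 2) s μ) :
    (∫ x in s, f x ∂μ) ^ 2 ≤ μ.real s * ∫ x in s, f x ^ 2 ∂μ := by
  -- The quadratic polynomial `c ↦ ∫ (f - c)²` over `s` is nonnegative, so its discriminant is not
  -- positive.
  have hq : ∀ c : ℝ, 0 ≤ (∫ x in s, f x ^ 2 ∂μ) - 2 * c * (∫ x in s, f x ∂μ)
      + c ^ 2 * μ.real s := by
    intro c
    have hci : IntegrableOn (fun _ => c ^ 2) s μ := integrableOn_const hs
    have e : ∫ x in s, (f x - c) ^ 2 ∂μ = (∫ x in s, f x ^ 2 ∂μ) - 2 * c * (∫ x in s, f x ∂μ)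
        + c ^ 2 * μ.real s := by
      have : ∀ x, (f x - c) ^ 2 = f x ^ 2 - 2 * c * f x + c ^ 2 := fun x => by ring
      simp only [this]
      have hi : IntegrableOn (fun x => f x ^ 2 - 2 * c * f x) s μ := hf2.sub (hf.const_mul _)
      rw [integral_add hi hci, integral_sub hf2 (hf.const_mul _),
        integral_const_mul, setIntegral_const, smul_eq_mul, mul_comm (μ.real s)]
    rw [← e]
    exact integral_nonneg fun x => sq_nonneg _
  have := discrim_le_zero (a := μ.real s) (b := -2 * ∫ x in s, f x ∂μ)
    (c := ∫ x in s, f x ^ 2 ∂μ) fun c => by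
      have := hq c
      linarith
  unfold discrim at this
  linarith

/-! ### Energy estimates from testing the equation -/

/-- Testing the equation with `G(u)` for a nondecreasing `G` with slope at most one. -/
theorem IsWeakSolution.normH1_comp_sq_le {p lam : ℝ} {u : Plane → ℝ} (hu : IsWeakSolution p lam u)
    {G G' : ℝ → ℝ} (hG : ∀ t, HasDerivAt G (G' t) t) (hc : Continuous G')
    (hG0 : ∀ t, 0 ≤ G' t) (hG1 : ∀ t, G' t ≤ 1) (h0 : G 0 = 0) (hsq : ∀ t, G t ^ 2 ≤ t * G t) :
    normH1 (fun x => G (u x)) ^ 2 ≤ ∫ x, |u x| ^ (p - 2) * u x * G (u x) := by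
  have hb : ∀ t, |G' t| ≤ 1 := fun t => by rw [abs_of_nonneg (hG0 t)]; exact hG1 t
  obtain ⟨hv, hvd, hva⟩ := hu.1.comp hG hc hb h0
  rw [← hu.2 _ hv, normH1_sq]
  have hi : Integrable (fun x => (∑ i : Fin 2, weakPartial i u x
      * weakPartial i (fun x => G (u x)) x) + 1 / lam ^ 2 * (angularDeriv u x
      * angularDeriv (fun x => G (u x)) x) + u x * G (u x)) volume :=
    ((integrable_finsetSum _ fun i _ => (hu.1.1.memLp_weakPartial i).integrable_mul
      (hv.1.memLp_weakPartial i)).add ((hu.1.2.integrable_mul hv.2).const_mul _)).add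
      (hu.1.1.1.integrable_mul hv.1.1)
  refine integral_mono_ae hv.1.integrable_normH1_integrand hi ?_
  filter_upwards [hvd 0, hvd 1, hva] with x h0 h1 ha
  simp only [Fin.sum_univ_two, h0, h1, ha]
  -- From `0 ≤ G' ≤ 1` follows `G'² ≤ G'`, which compares the energy of `G(u)` with the pairing of
  -- `u` and `G(u)`.
  have key : ∀ a : ℝ, (G' (u x) * a) ^ 2 ≤ a * (G' (u x) * a) := fun a => by
    have h2 : G' (u x) * G' (u x) ≤ G' (u x) := mul_le_of_le_one_left (hG0 _) (hG1 _)
    nlinarith [mul_le_mul_of_nonneg_right h2 (sq_nonneg a)]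
  have hang : 0 ≤ 1 / lam ^ 2 * (angularDeriv u x * (G' (u x) * angularDeriv u x)) := by
    have := (sq_nonneg _).trans (key (angularDeriv u x))
    positivity
  linarith [key (weakPartial 0 u x), key (weakPartial 1 u x), hsq (u x)]

/-- The `H¹` norm of a truncation of a solution is controlled by the values of the solution on the
corresponding superlevel set. -/
theorem IsWeakSolution.normH1_truncation_sq_le {p lam : ℝ} {u : Plane → ℝ}
    (hu : IsWeakSolution p lam u) {m : ℕ} (hm : p - 1 ≤ m) {k : ℝ} (hk : 1 ≤ k)
    (hint : Integrable (fun x => u x ^ (2 * m)) volume)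
    {G G' : ℝ → ℝ} (hG : ∀ t, HasDerivAt G (G' t) t) (hc : Continuous G')
    (hG0 : ∀ t, 0 ≤ G' t) (hG1 : ∀ t, G' t ≤ 1) (h0 : G 0 = 0) (hsq : ∀ t, G t ^ 2 ≤ t * G t)
    (hz : ∀ t, |t| ≤ k → G t = 0) {s : Set Plane} (hs : MeasurableSet s)
    (hsu : ∀ᵐ x, k < |u x| → x ∈ s) :
    normH1 (fun x => G (u x)) ^ 2 ≤ ∫ x in s, u x ^ (2 * m) := by
  have hb : ∀ t, |G' t| ≤ 1 := fun t => by rw [abs_of_nonneg (hG0 t)]; exact hG1 t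
  have hv := (hu.1.comp hG hc hb h0).1
  have h1 := hu.normH1_comp_sq_le hG hc hG0 hG1 h0 hsq
  have hi1 : Integrable (fun x => 1 / 2 * s.indicator (fun x => u x ^ (2 * m)) x) volume :=
    (hint.indicator hs).const_mul _
  have hi2 : Integrable (fun x => 1 / 2 * G (u x) ^ 2) volume := hv.1.1.integrable_sq.const_mul _
  -- Where `G(u) ≠ 0` one has `|u| > 1`, so `|u|^(p-1) ≤ |u|^m`, and Young's inequality applies.
  -- Half of `∫ G(u)²` is later absorbed into the left-hand side.
  have h2 : ∫ x, |u x| ^ (p - 2) * u x * G (u x) ≤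
      ∫ x, (1 / 2 * s.indicator (fun x => u x ^ (2 * m)) x + 1 / 2 * G (u x) ^ 2) := by
    refine integral_mono_of_nonneg (ae_of_all _ fun x => ?_) (hi1.add hi2) ?_
    · have : 0 ≤ u x * G (u x) := (sq_nonneg _).trans (hsq _)
      simp only [Pi.zero_apply, mul_assoc]
      positivity
    · filter_upwards [hsu] with x hx
      by_cases hux : |u x| ≤ k
      · rw [hz _ hux]
        have : 0 ≤ s.indicator (fun x => u x ^ (2 * m)) x :=
          Set.indicator_nonneg (fun x _ => (even_two_mul m).pow_nonneg _) x
        linarith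
      · rw [not_le] at hux
        rw [Set.indicator_of_mem (hx hux)]
        have hu1 : 1 ≤ |u x| := hk.trans hux.le
        have hpow : |u x| ^ (p - 2) * |u x| ≤ |u x| ^ m := by
          rw [← Real.rpow_natCast]
          calc |u x| ^ (p - 2) * |u x| = |u x| ^ (p - 1) := by
                rw [← Real.rpow_add_one (by positivity)]
                ring_nf
            _ ≤ _ := Real.rpow_le_rpow_of_exponent_le hu1 hm
        have habs : |u x| ^ (p - 2) * u x * G (u x) ≤ |u x| ^ m * |G (u x)| := by
          refine (le_abs_self _).trans ?_
          rw [abs_mul, abs_mul, abs_of_nonneg (by positivity : 0 ≤ |u x| ^ (p - 2))]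
          gcongr
        have e1 : u x ^ (2 * m) = (|u x| ^ m) ^ 2 := by
          rw [← pow_mul, mul_comm m 2, (even_two_mul m).pow_abs]
        have e2 : G (u x) ^ 2 = |G (u x)| ^ 2 := (sq_abs _).symm
        rw [e1, e2]
        nlinarith [sq_nonneg (|u x| ^ m - |G (u x)|)]
  rw [integral_add hi1 hi2, integral_const_mul, integral_const_mul, integral_indicator hs] at h2
  have h3 := hv.1.integral_sq_le
  linarith

/-! ### Lower bound for the norm of nontrivial solutions -/

/-- Below the point `t₀` where `t ^ (p - 2) = 1 / 2` the constant suffices; above it `B = t₀ ^ (-2m)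
≥ 1` lets the power dominate. The value `1 / 2` allows absorption into the `L²` part of the norm. -/
theorem exists_rpow_le_half_add {p : ℝ} (hp : 2 < p) {m : ℕ} (hm : p - 2 ≤ 2 * m) :
    ∃ B : ℝ, 0 < B ∧ ∀ t : ℝ, 0 ≤ t → t ^ (p - 2) ≤ 1 / 2 + B * t ^ (2 * m) := by
  have hp2 : 0 < p - 2 := by linarith
  set t₀ : ℝ := (1 / 2 : ℝ) ^ (1 / (p - 2)) with ht₀
  have h0 : 0 < t₀ := by positivity
  have h1 : t₀ ≤ 1 := Real.rpow_le_one (by norm_num) (by norm_num) (by positivity)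
  have hB : 1 ≤ 1 / t₀ ^ (2 * m) := by
    rw [le_div_iff₀ (by positivity), one_mul]
    exact pow_le_one₀ h0.le h1
  refine ⟨1 / t₀ ^ (2 * m), by positivity, fun t ht => ?_⟩
  rcases le_total t t₀ with h | h
  · have h2 : t ^ (p - 2) ≤ t₀ ^ (p - 2) := Real.rpow_le_rpow ht h hp2.le
    have h3 : t₀ ^ (p - 2) = 1 / 2 := by
      rw [ht₀, ← Real.rpow_mul (by norm_num), one_div_mul_cancel hp2.ne', Real.rpow_one]
    have h4 : 0 ≤ 1 / t₀ ^ (2 * m) * t ^ (2 * m) := by positivity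
    linarith
  · have h2 : t ^ (p - 2) ≤ 1 / t₀ ^ (2 * m) * t ^ (2 * m) := by
      rcases le_total t 1 with h3 | h3
      · refine (Real.rpow_le_one ht h3 hp2.le).trans ?_
        rw [one_div_mul_eq_div, le_div_iff₀ (by positivity), one_mul]
        gcongr
      · calc t ^ (p - 2) ≤ t ^ ((2 * m : ℕ) : ℝ) :=
              Real.rpow_le_rpow_of_exponent_le h3 (by push_cast; exact hm)
          _ = 1 * t ^ (2 * m) := by rw [Real.rpow_natCast, one_mul]
          _ ≤ _ := by gcongr
    linarith

/-- Nontrivial solutions are bounded away from zero in `H¹`, uniformly in the coefficient of the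
angular derivative. -/
theorem exists_normH1_lower_bound {p : ℝ} (hp : 2 < p) {m : ℕ} (hm0 : m ≠ 0)
    (hm : p - 2 ≤ 2 * m) :
    ∃ Q : ℝ, 1 ≤ Q ∧ ∀ (lam : ℝ) (u : Plane → ℝ), IsWeakSolution p lam u → 0 < normH1 u →
      1 ≤ Q * normH1 u := by
  obtain ⟨B, hB, hpow⟩ := exists_rpow_le_half_add hp hm
  obtain ⟨K, hK, hsob⟩ := exists_integral_pow_le m
  refine ⟨2 * B * K + 1, by linarith [mul_pos hB hK], fun lam u hu hN => ?_⟩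
  obtain ⟨hint, hle⟩ := hsob u hu.1.1
  have h1 := hu.normH1_comp_sq_le (G := fun t => t) (G' := fun _ => 1) (fun t => hasDerivAt_id t)
    continuous_const (fun _ => zero_le_one) (fun _ => le_rfl) rfl fun t => (sq t).le
  have hi1 : Integrable (fun x => 1 / 2 * u x ^ 2) volume := hu.1.1.1.integrable_sq.const_mul _
  have hi2 : Integrable (fun x => B * u x ^ (2 * (m + 1))) volume := hint.const_mul _
  have h2 : ∫ x, |u x| ^ (p - 2) * u x * u x ≤
      ∫ x, (1 / 2 * u x ^ 2 + B * u x ^ (2 * (m + 1))) := by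
    refine integral_mono_of_nonneg (ae_of_all _ fun x => ?_) (hi1.add hi2)
      (ae_of_all _ fun x => ?_)
    · simp only [Pi.zero_apply, mul_assoc]
      have := mul_self_nonneg (u x)
      positivity
    · have h := mul_le_mul_of_nonneg_right (hpow |u x| (abs_nonneg _)) (sq_nonneg (u x))
      rw [(even_two_mul m).pow_abs] at h
      calc |u x| ^ (p - 2) * u x * u x = |u x| ^ (p - 2) * u x ^ 2 := by ring
        _ ≤ _ := h
        _ = _ := by ring
  rw [integral_add hi1 hi2, integral_const_mul, integral_const_mul] at h2
  have h3 := hu.1.1.integral_sq_le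
  set N := normH1 u
  have h4 : N ^ 2 ≤ 2 * (B * (K * N ^ (2 * (m + 1)))) := by
    have := mul_le_mul_of_nonneg_left hle hB.le
    have h1' : N ^ 2 ≤ ∫ x, |u x| ^ (p - 2) * u x * u x := h1
    linarith
  have h5 : N ^ 2 * 1 ≤ N ^ 2 * (2 * B * K * N ^ (2 * m)) := by
    rw [mul_one]
    refine h4.trans (le_of_eq ?_)
    ring
  have h6 := le_of_mul_le_mul_left h5 (by positivity)
  -- What is known is `1 ≤ 2 B K N ^ (2m)`. Taking `Q = 2 B K + 1 ≥ 1` avoids roots, because `2 B K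
  -- ≤ Q ^ (2m)`.
  by_contra! hlt
  have hq : 1 ≤ 2 * B * K + 1 := by linarith [mul_pos hB hK]
  have h7 : ((2 * B * K + 1) * N) ^ (2 * m) < 1 := pow_lt_one₀ (by positivity) hlt (by omega)
  rw [mul_pow] at h7
  have h8 : 2 * B * K * N ^ (2 * m) ≤ (2 * B * K + 1) ^ (2 * m) * N ^ (2 * m) := by
    gcongr
    exact (by linarith : 2 * B * K ≤ 2 * B * K + 1).trans (le_self_pow₀ hq (by omega))
  linarith

/-! ### Level set decay and the uniform bound -/

/-- The decay of the superlevel sets of a solution. -/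
theorem exists_level_decay {p : ℝ} {j : ℕ} (hj : p - 1 ≤ (j + 1 : ℕ)) :
    ∃ L : ℝ, 1 ≤ L ∧ ∀ (lam : ℝ) (u : Plane → ℝ), IsWeakSolution p lam u → ∀ k h : ℝ, 1 ≤ k →
      k < h → (h - k) ^ 8 * volume.real {x | h < |u x|}
        ≤ (L * normH1 u ^ (j + 1)) ^ 8 * volume.real {x | k < |u x|} ^ 2 := by
  -- The three embeddings are `L⁸` for `G(u)`, `L^(4(j+1))` for the Cauchy–Schwarz step, and
  -- `L^(2(j+1))` for the energy estimate.
  obtain ⟨K, hK, hsob⟩ := exists_integral_pow_le 3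
  obtain ⟨K', hK', hsob'⟩ := exists_integral_pow_le (2 * j + 1)
  obtain ⟨K'', hK'', hsob''⟩ := exists_integral_pow_le j
  refine ⟨4 * ((K + 1) * (K' + 1)), by nlinarith, fun lam u hu k h hk hkh => ?_⟩
  obtain ⟨G, G', hG, hc, hG0, hG1, h0, hz, hsq, hlow⟩ := exists_truncation (by linarith) hkh
  have hb : ∀ t, |G' t| ≤ 1 := fun t => by rw [abs_of_nonneg (hG0 t)]; exact hG1 t
  have hv := (hu.1.comp hG hc hb h0).1
  obtain ⟨hi8, hle8⟩ := hsob _ hv.1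
  obtain ⟨hi4, hle4⟩ := hsob' u hu.1.1
  have hi2 := (hsob'' u hu.1.1).1
  set N := normH1 u
  set E := normH1 fun x => G (u x)
  have hfin : volume {x | k < |u x|} ≠ ⊤ := by
    have h2 := hu.1.1.1.integrable_sq.measure_gt_lt_top (zero_lt_one' ℝ)
    refine ((measure_mono fun x (hx : k < |u x|) => ?_).trans_lt h2).ne
    change 1 < u x ^ 2
    rw [← sq_abs]
    nlinarith
  have hnull : NullMeasurableSet {x | k < |u x|} volume :=
    nullMeasurableSet_lt aemeasurable_const hu.1.1.1.1.aemeasurable.abs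
  -- The superlevel set is only null measurable, as `u` is measurable only up to a null set.
  obtain ⟨s, -, hs, hse⟩ := hnull.exists_measurable_superset_ae_eq
  have hsu : ∀ᵐ x, k < |u x| → x ∈ s := hse.symm.le
  have hsr : volume.real s = volume.real {x | k < |u x|} := measureReal_congr hse
  have hsfin : volume s ≠ ⊤ := by rwa [measure_congr hse]
  have hE := hu.normH1_truncation_sq_le hj hk hi2 hG hc hG0 hG1 h0 hsq hz hs hsu
  have e4 : ∀ x, (u x ^ (2 * (j + 1))) ^ 2 = u x ^ (2 * (2 * j + 1 + 1)) := fun x => by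
    rw [← pow_mul]
    ring_nf
  have hcs := sq_setIntegral_le hsfin (f := fun x => u x ^ (2 * (j + 1))) hi2.integrableOn
    (by simpa only [e4] using hi4.integrableOn)
  simp only [e4] at hcs
  have hset : ∫ x in s, u x ^ (2 * (2 * j + 1 + 1)) ≤ K' * N ^ (2 * (2 * j + 1 + 1)) :=
    (setIntegral_le_integral hi4 (ae_of_all _ fun x => (even_two_mul _).pow_nonneg _)).trans hle4
  rw [hsr] at hcs
  set a := volume.real {x | k < |u x|}
  have ha0 : 0 ≤ a := measureReal_nonneg
  have hmarkov : ((h - k) / 4) ^ 8 * volume.real {x | h < |u x|} ≤ ∫ x, G (u x) ^ (2 * (3 + 1)) := by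
    refine le_trans ?_ (mul_meas_ge_le_integral_of_nonneg
      (ae_of_all _ fun x => (even_two_mul _).pow_nonneg _) hi8 (((h - k) / 4) ^ 8))
    refine mul_le_mul_of_nonneg_left (measureReal_mono (fun x (hx : h < |u x|) => ?_) ?_)
      (by have := sub_pos.2 hkh; positivity)
    · have := hlow _ hx.le
      change ((h - k) / 4) ^ 8 ≤ G (u x) ^ 8
      rw [← (by decide : Even 8).pow_abs (G (u x))]
      have := sub_pos.2 hkh
      gcongr
    · exact (hi8.measure_ge_lt_top (by have := sub_pos.2 hkh; positivity)).ne
  set I := ∫ x in s, u x ^ (2 * (j + 1))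
  have hI0 : 0 ≤ I := (sq_nonneg E).trans hE
  have hN : 0 ≤ N := normH1_nonneg u
  -- Here the square of `a` arises: `E² ≤ I` and `I² ≤ a ∫ u^(4(j+1))` give `E⁸ ≤ I⁴`, quadratic in
  -- `a`.
  have hEI : E ^ (2 * (3 + 1)) ≤ (a * (K' * N ^ (2 * (2 * j + 1 + 1)))) ^ 2 := by
    calc E ^ (2 * (3 + 1)) = (E ^ 2) ^ 4 := by ring
      _ ≤ I ^ 4 := by gcongr
      _ = (I ^ 2) ^ 2 := by ring
      _ ≤ _ := by
        refine pow_le_pow_left₀ (sq_nonneg _) (hcs.trans ?_) 2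
        gcongr
  have hconst : K * K' ^ 2 ≤ ((K + 1) * (K' + 1)) ^ 8 := by
    have h1 : K ≤ (K + 1) ^ 8 :=
      (by linarith : K ≤ K + 1).trans (le_self_pow₀ (by linarith) (by norm_num))
    have h2 : K' ^ 2 ≤ (K' + 1) ^ 8 :=
      (pow_le_pow_left₀ hK'.le (by linarith) 2).trans
        (pow_le_pow_right₀ (by linarith) (by norm_num))
    rw [mul_pow]
    gcongr
  calc (h - k) ^ 8 * volume.real {x | h < |u x|}
      = 4 ^ 8 * (((h - k) / 4) ^ 8 * volume.real {x | h < |u x|}) := by ring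
    _ ≤ 4 ^ 8 * (K * (a * (K' * N ^ (2 * (2 * j + 1 + 1)))) ^ 2) := by
      refine mul_le_mul_of_nonneg_left (hmarkov.trans (hle8.trans ?_)) (by norm_num)
      exact mul_le_mul_of_nonneg_left hEI hK.le
    _ = 4 ^ 8 * (K * K' ^ 2) * ((N ^ (j + 1)) ^ 8 * a ^ 2) := by ring
    _ ≤ 4 ^ 8 * ((K + 1) * (K' + 1)) ^ 8 * ((N ^ (j + 1)) ^ 8 * a ^ 2) := by gcongr
    _ = _ := by ring

/-- An explicit bound for solutions in terms of a power of their `H¹` norm. -/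
theorem exists_ae_abs_le {p : ℝ} (hp : 2 < p) {j : ℕ} (hj : p - 1 ≤ (j + 1 : ℕ)) :
    ∃ C : ℝ, 0 < C ∧ ∀ (lam : ℝ) (u : Plane → ℝ), IsWeakSolution p lam u →
      ∀ᵐ x, |u x| ≤ C * normH1 u ^ (j + 1) := by
  obtain ⟨Q, hQ, hlower⟩ := exists_normH1_lower_bound hp (m := j + 1) (by simp) (by linarith)
  obtain ⟨L, hL, hdecay⟩ := exists_level_decay hj
  refine ⟨2 * Q ^ (j + 1) + 4 * L, by positivity, fun lam u hu => ?_⟩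
  have hu2 := hu.1.1.1
  have hsq := hu.1.1.integral_sq_le
  rcases (normH1_nonneg u).eq_or_lt with hN | hN
  · rw [← hN, zero_pow two_ne_zero] at hsq
    have h0 : ∫ x, u x ^ 2 = 0 := le_antisymm hsq (integral_nonneg fun x => sq_nonneg _)
    have h1 := (integral_eq_zero_iff_of_nonneg (fun x => sq_nonneg (u x)) hu2.integrable_sq).1 h0
    filter_upwards [h1] with x hx
    have hx0 : u x = 0 := by simpa using hx
    rw [hx0, abs_zero, ← hN]
    simp
  · have hQN := hlower lam u hu hN
    have hdec := hdecay lam u hu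
    set N := normH1 u
    have hfin : ∀ k : ℝ, 0 < k → volume {x | k < |u x|} ≠ ⊤ := fun k hk => by
      have h2 := hu2.integrable_sq.measure_gt_lt_top (ε := k ^ 2) (by positivity)
      refine ((measure_mono fun x (hx : k < |u x|) => ?_).trans_lt h2).ne
      change k ^ 2 < u x ^ 2
      rw [← sq_abs (u x)]
      gcongr
    -- Chebyshev's inequality gives at most `N² / (1 + N)²`.
    have hstart : volume.real {x | 1 + N < |u x|} ≤ 1 := by
      have hm := mul_meas_ge_le_integral_of_nonneg (ae_of_all _ fun x => sq_nonneg (u x))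
        hu2.integrable_sq ((1 + N) ^ 2)
      have hsub : volume.real {x | 1 + N < |u x|} ≤ volume.real {x | (1 + N) ^ 2 ≤ u x ^ 2} := by
        refine measureReal_mono (fun x (hx : 1 + N < |u x|) => ?_)
          (hu2.integrable_sq.measure_ge_lt_top (by positivity)).ne
        change (1 + N) ^ 2 ≤ u x ^ 2
        rw [← sq_abs (u x)]
        gcongr
      have h3 : (1 + N) ^ 2 * volume.real {x | 1 + N < |u x|} ≤ (1 + N) ^ 2 * 1 := by
        calc _ ≤ _ := mul_le_mul_of_nonneg_left hsub (by positivity)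
          _ ≤ _ := hm
          _ ≤ N ^ 2 := hsq
          _ ≤ _ := by nlinarith
      exact le_of_mul_le_mul_left h3 (by positivity)
    -- The maximum secures monotonicity on all of `ℝ`: at negative levels the set has infinite
    -- measure, to which `volume.real` assigns `0`.
    have hzero := eq_zero_of_level_decay
      (a := fun k => volume.real {x | max k (1 + N) < |u x|}) (k₀ := 1 + N)
      (D := L * N ^ (j + 1)) (fun k h hkh => measureReal_mono
        (fun x (hx : max h (1 + N) < |u x|) => (max_le_max_right _ hkh).trans_lt hx)
        (hfin _ (lt_max_of_lt_right (by positivity))))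
      (fun k => measureReal_nonneg) (by positivity) (by simpa using hstart)
      (fun k h hk hkh => by
        simp only [max_eq_left hk, max_eq_left (hk.trans hkh.le)]
        exact hdec k h (by linarith) hkh)
    have hDpos : 0 < L * N ^ (j + 1) := by positivity
    simp only [max_eq_left (by linarith : 1 + N ≤ 1 + N + 4 * (L * N ^ (j + 1)))] at hzero
    rw [measureReal_eq_zero_iff (hfin _ (by positivity))] at hzero
    have hae : ∀ᵐ x, |u x| ≤ 1 + N + 4 * (L * N ^ (j + 1)) := by
      rw [ae_iff]
      simpa only [not_le] using hzero
    -- Since `1 ≤ Q N`, both `1` and `N` are at most `(Q N) ^ (j + 1)`, which explains the constant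
    -- `2 Q ^ (j + 1) + 4 L`.
    have h1 : 1 ≤ Q ^ (j + 1) * N ^ (j + 1) := by
      rw [← mul_pow]
      exact one_le_pow₀ hQN
    have h2 : N ≤ Q ^ (j + 1) * N ^ (j + 1) := by
      rw [← mul_pow]
      exact (le_mul_of_one_le_left hN.le hQ).trans (le_self_pow₀ hQN (by simp))
    filter_upwards [hae] with x hx
    linarith

end AngularSchrodinger

end

theorem lemmaA1 (p : ℝ) (hp : 2 < p) :
    ∃ C σ : ℝ, 0 < C ∧ 0 < σ ∧
      ∀ (lam : ℝ), 0 < lam → ∀ u : AngularSchrodinger.Plane → ℝ,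
        AngularSchrodinger.IsWeakSolution p lam u →
          MeasureTheory.MemLp u ⊤ MeasureTheory.volume ∧
            (MeasureTheory.eLpNorm u ⊤ MeasureTheory.volume).toReal
              ≤ C * AngularSchrodinger.normH1 u ^ σ := by
  obtain ⟨j, hj⟩ := exists_nat_ge p
  obtain ⟨C, hC, hbd⟩ := AngularSchrodinger.exists_ae_abs_le hp (j := j) (by push_cast; linarith)
  refine ⟨C, ((j + 1 : ℕ) : ℝ), hC, by positivity, fun lam _ u hu => ?_⟩
  have hae := hbd lam u hu
  have hN := AngularSchrodinger.normH1_nonneg u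
  have hle : eLpNorm u ⊤ volume
      ≤ ENNReal.ofReal (C * AngularSchrodinger.normH1 u ^ (j + 1)) := by
    rw [eLpNorm_exponent_top]
    exact eLpNormEssSup_le_of_ae_bound hae
  refine ⟨⟨hu.1.1.1.1, hle.trans_lt ENNReal.ofReal_lt_top⟩, ?_⟩
  rw [Real.rpow_natCast]
  exact ENNReal.toReal_le_of_le_ofReal (by positivity) hle
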